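/- **Conventions.** All locally compact groups are Hausdorff and are endowed with a right-invariant (regular) Haar measure $dy$. A *length* on a locally compact group $G$ is a Borel function $\ell\colon G\to[0,\infty)$ with $\ell(1)=0$, $\ell(x^{-1})=\ell(x)$ and $\ell(xy)\le\ell(x)+\ell(y)$ for all $x,y\in G$. A *word-length* on $G$ is a length of the form $\ell(x)=\min\{n\ge 0: x\in (S\cup S^{-1})^n\}$, where $S$ is a relatively compact subset generating $G$. For $f\in C_c(G)$ (complex-valued) let $\|f\|_{op}$ be the norm of the operator $T_f$ on $L^2(G)$ given by $T_fg(x)=\int_G f(y^{-1})g(yx)\,dy$, and let $\ell(f)=\sup\{\ell(x): f(x)\neq 0\}$ (with $\sup\emptyset=0$). The group $G$ has *property RD with respect to $\ell$* if there are constants $s,C>0$ such that $\|f\|_{op}\le C(1+\ell(f))^s\|f\|_2$ for every $f\in C_c(G)$. A compactly generated group has *property RD* if it has property RD with respect to some length; equivalently, with respect to each of its word-lengths. **Theorem.** Let $1\to N\xrightarrow{\iota} G\xrightarrow{\pi} Q\to 1$ be a short exact sequence of compactly generated locally compact groups ($\iota$ is a homeomorphism onto the closed normal subgroup $\ker\pi$,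 and $\pi$ is a continuous open surjection). Suppose that $Q$ has property RD with respect to a word-length on $Q$, and that $N$ has property RD with respect to the restriction $\ell_G\circ\iota$ of a word-length $\ell_G$ on $G$. Then $G$ has property RD: it has property RD with respect to some length and with respect to each of its word-lengths. -/

import Mathlib

open MeasureTheory
open scoped ENNReal Pointwise

noncomputable section

namespace RapidDecay

/-- A length on a topological group: a Borel function `ℓ : G → [0, ∞)` which vanishes at the
identity, is symmetric and is subadditive. -/
structure IsLength {G : Type*} [Group G] [MeasurableSpace G] (ℓ : G → ℝ) : Prop where
  measurable : Measurable ℓ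
  nonneg : ∀ x, 0 ≤ ℓ x
  map_one : ℓ 1 = 0
  map_inv : ∀ x, ℓ x⁻¹ = ℓ x
  map_mul_le : ∀ x y, ℓ (x * y) ≤ ℓ x + ℓ y

/-- The word-length `x ↦ min {n : x ∈ (S ∪ S⁻¹)ⁿ}` of a subset `S` of a group; it is only used
for generating sets `S`, so that the minimum is over a nonempty set. -/
def wordLength {G : Type*} [Group G] (S : Set G) (x : G) : ℝ :=
  ((sInf {n : ℕ | x ∈ (S ∪ S⁻¹) ^ n} : ℕ) : ℝ)

/-- `ℓ` is a word-length on the topological group `G`: it is a length (in particular Borel), and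
it is the word-length of some relatively compact generating set. -/
def IsWordLength {G : Type*} [Group G] [TopologicalSpace G] [MeasurableSpace G]
    (ℓ : G → ℝ) : Prop :=
  IsLength ℓ ∧ ∃ S : Set G,
    IsCompact (closure S) ∧ Subgroup.closure S = ⊤ ∧ ℓ = wordLength S

/-- A topological group is compactly generated if it is generated by a compact subset. -/
def IsCompactlyGenerated (G : Type*) [Group G] [TopologicalSpace G] : Prop :=
  ∃ K : Set G, IsCompact K ∧ Subgroup.closure K = ⊤

section Convolution

variable {G : Type*} [Group G] [TopologicalSpace G] [IsTopologicalGroup G]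
  [LocallyCompactSpace G] [MeasurableSpace G] [BorelSpace G]

variable (G) in
/-- The right-invariant Haar measure: the image under inversion of the (regular) left Haar
measure. -/
def rightHaar : Measure G := (Measure.haar : Measure G).inv

/-- Left convolution `(T_f g)(x) = ∫ f(y⁻¹) g(yx) dy` with respect to right Haar measure. -/
def conv (f g : G → ℂ) (x : G) : ℂ := ∫ y, f y⁻¹ * g (y * x) ∂(rightHaar G)

/-- The norm of `T_f` as an operator on `L²(G)`: the least `c` such that
`‖T_f g‖₂ ≤ c ‖g‖₂` for all square-integrable `g`. -/
def opNorm (f : G → ℂ) : ℝ≥0∞ :=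
  sInf {c : ℝ≥0∞ | ∀ g : G → ℂ, MemLp g 2 (rightHaar G) →
    eLpNorm (conv f g) 2 (rightHaar G) ≤ c * eLpNorm g 2 (rightHaar G)}

/-- `ℓ(f) = sup {ℓ(x) : f(x) ≠ 0}`. -/
def supportLength (ℓ : G → ℝ) (f : G → ℂ) : ℝ≥0∞ :=
  ⨆ x ∈ Function.support f, ENNReal.ofReal (ℓ x)

/-- Property RD with respect to a length `ℓ`: there are `s, C > 0` such that
`‖f‖_op ≤ C (1 + ℓ(f))ˢ ‖f‖₂` for every continuous compactly supported `f : G → ℂ`. -/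
def HasRDWith (ℓ : G → ℝ) : Prop :=
  ∃ s C : ℝ, 0 < s ∧ 0 < C ∧ ∀ f : G → ℂ, Continuous f → HasCompactSupport f →
    opNorm f ≤ ENNReal.ofReal C * (1 + supportLength ℓ f) ^ s * eLpNorm f 2 (rightHaar G)

variable (G) in
/-- Property RD of a compactly generated group: property RD with respect to some length, and also
with respect to each of its word-lengths (by domination of lengths the two are equivalent, and
both are required here). -/
def HasPropertyRD : Prop :=
  (∃ ℓ : G → ℝ, IsLength ℓ ∧ HasRDWith ℓ) ∧ ∀ ℓ : G → ℝ, IsWordLength ℓ → HasRDWith ℓ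

end Convolution

end RapidDecay

end

/-!
Write `dn`, `dq` for right Haar measures on `N` and `Q`. Right Haar measure on `G` is, up to a
constant, `∫_Q ∫_N k(n x) dn dq` with `q = π x` (Weil's formula, proved in Mathlib for left Haar
measures and transported by inversion). Hence, for nonnegative `f, g ∈ C_c(G)`, the function
`F'(π x) = ‖n ↦ f(n x)‖_{L²(N)}` belongs to `C_c(Q)`, and its `L²` norm is that of `f` up to the
constant; the same holds for `G'` built from `g`.

Restricted to a coset of `N`, the convolution `f * g` is an integral over `q ∈ Q` of convolutions
on `N` of translates of `f` and `g` restricted to cosets. If `f` is supported in `{ℓ ≤ R}`, the coset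
representative can be chosen in the support of `f`, so that the translate of `f` is supported in
`{ℓ ∘ ι ≤ 2R}`, and property RD of `N` bounds each of these convolutions
(`RDBound.integral_fiber_le`). Integrating over `Q` gives
`‖n ↦ (f * g)(n x)‖ ≤ K (F' * G')(π x)` with `K` polynomial in `R`
(`RDBound.l2norm_fiber_convReal_le`; instead of Minkowski's integral inequality, the square of the
left-hand side is written as a pairing). As lengths on `Q` pulled back to `G` are
dominated by word-lengths on `G`, property RD of `Q` applied to `F' * G'` concludes
(`RDBound.extension`). No measurable section and no unimodularity is needed.

The groups are not assumed second countable, so Fubini's theorem is only used for continuous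
functions with compact support. This suffices: `RDBound.hasRDWith` recovers the operator norm on
`L²(G)` by density. The comparison of lengths, `IsLength.exists_le_mul_wordLength`, rests on
Steinhaus' theorem, which makes a Borel length bounded on compact sets.
-/

namespace RapidDecay

open Filter Topology

/-! ### Integrals of continuous functions with compact support -/

/-- Membership in the cone of nonnegative real functions in `C_c(X)`. -/
structure IsCcNonneg {X : Type*} [TopologicalSpace X] (f : X → ℝ) : Prop where
  continuous : Continuous f
  hasCompactSupport : HasCompactSupport f
  nonneg : ∀ x, 0 ≤ f x

section Integrals

variable {X Y : Type*} [TopologicalSpace X] [TopologicalSpace Y]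

lemma IsCcNonneg.of_zero_off [R1Space X] {f : X → ℝ} (hc : Continuous f) (h0 : ∀ x, 0 ≤ f x)
    {k : Set X} (hk : IsCompact k) (hz : ∀ x, x ∉ k → f x = 0) : IsCcNonneg f :=
  ⟨hc, HasCompactSupport.intro hk fun x hx => hz x hx, h0⟩

lemma IsCcNonneg.eq_zero {f : X → ℝ} (_ : IsCcNonneg f) {x : X} (hx : x ∉ tsupport f) :
    f x = 0 := image_eq_zero_of_notMem_tsupport hx

lemma IsCcNonneg.mul {f g : X → ℝ} (hf : IsCcNonneg f) (hg : IsCcNonneg g) :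
    IsCcNonneg (fun x => f x * g x) :=
  ⟨hf.continuous.mul hg.continuous, hf.hasCompactSupport.mul_right,
    fun x => mul_nonneg (hf.nonneg x) (hg.nonneg x)⟩

lemma IsCcNonneg.sq {f : X → ℝ} (hf : IsCcNonneg f) : IsCcNonneg (fun x => f x ^ 2) := by
  simpa only [pow_two] using hf.mul hf

lemma IsCcNonneg.sqrt {f : X → ℝ} (hf : IsCcNonneg f) : IsCcNonneg (fun x => √(f x)) :=
  ⟨hf.continuous.sqrt, hf.hasCompactSupport.comp_left Real.sqrt_zero, fun _ => Real.sqrt_nonneg _⟩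

lemma IsCcNonneg.comp_isClosedEmbedding {f : X → ℝ} (hf : IsCcNonneg f) {e : Y → X}
    (he : Topology.IsClosedEmbedding e) : IsCcNonneg (fun y => f (e y)) :=
  ⟨hf.continuous.comp he.continuous, hf.hasCompactSupport.comp_isClosedEmbedding he,
    fun _ => hf.nonneg _⟩

lemma IsCcNonneg.integrable [MeasurableSpace X] [OpensMeasurableSpace X] {μ : Measure X}
    [IsFiniteMeasureOnCompacts μ] {f : X → ℝ} (hf : IsCcNonneg f) : Integrable f μ :=
  hf.continuous.integrable_of_hasCompactSupport hf.hasCompactSupport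

lemma IsCcNonneg.memLp [MeasurableSpace X] [OpensMeasurableSpace X] {μ : Measure X}
    [IsFiniteMeasureOnCompacts μ] {f : X → ℝ} (hf : IsCcNonneg f) (p : ℝ≥0∞) : MemLp f p μ :=
  hf.continuous.memLp_of_hasCompactSupport hf.hasCompactSupport

/-- No countability assumption is needed: the integrand vanishes off a fixed compact set. -/
lemma continuous_integral_of_zero_off {E : Type*} [NormedAddCommGroup E] [NormedSpace ℝ E]
    [MeasurableSpace Y] [OpensMeasurableSpace Y] {μ : Measure Y}
    [IsFiniteMeasureOnCompacts μ] {F : X → Y → E} (hF : Continuous F.uncurry) {k : Set Y}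
    (hk : IsCompact k) (h0 : ∀ x y, y ∉ k → F x y = 0) : Continuous fun x => ∫ y, F x y ∂μ := by
  have := continuousOn_integral_bilinear_of_locally_integrable_of_compact_support (μ := μ)
    (ContinuousLinearMap.lsmul ℝ ℝ) (f := F) (s := Set.univ) (k := k) (g := fun _ => (1 : ℝ)) hk
    hF.continuousOn (fun p x _ hx => h0 p x hx) (integrableOn_const hk.measure_lt_top.ne)
  simpa [continuousOn_univ] using this

lemma integral_mul_le_sqrt_mul_sqrt [MeasurableSpace X] [OpensMeasurableSpace X] {μ : Measure X}
    [IsFiniteMeasureOnCompacts μ] {f g : X → ℝ} (hf : IsCcNonneg f) (hg : IsCcNonneg g) :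
    ∫ x, f x * g x ∂μ ≤ √(∫ x, f x ^ 2 ∂μ) * √(∫ x, g x ^ 2 ∂μ) := by
  have h := integral_mul_le_Lp_mul_Lq_of_nonneg (μ := μ) Real.HolderConjugate.two_two
    (ae_of_all _ hf.nonneg) (ae_of_all _ hg.nonneg) (hf.memLp _) (hg.memLp _)
  simpa [Real.sqrt_eq_rpow] using h

lemma integral_integral_swap_of_zero_off [R1Space X] [R1Space Y] [MeasurableSpace X]
    [OpensMeasurableSpace X] [MeasurableSpace Y] [OpensMeasurableSpace Y] {μ : Measure X}
    {ν : Measure Y} [IsFiniteMeasureOnCompacts μ] [IsFiniteMeasureOnCompacts ν] {F : X → Y → ℝ}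
    (hF : Continuous F.uncurry) {k : Set X} {l : Set Y} (hk : IsCompact k) (hl : IsCompact l)
    (hFk : ∀ x y, x ∉ k → F x y = 0) (hFl : ∀ x y, y ∉ l → F x y = 0) :
    ∫ x, ∫ y, F x y ∂ν ∂μ = ∫ y, ∫ x, F x y ∂μ ∂ν := by
  refine integral_integral_swap_of_hasCompactSupport hF (HasCompactSupport.intro (hk.prod hl) ?_)
  rintro ⟨x, y⟩ hxy
  by_cases hx : x ∈ k
  · exact hFl x y fun hy => hxy ⟨hx, hy⟩
  · exact hFk x y hx

end Integrals

/-! ### Right Haar measure and real convolution -/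

section Conv

variable {G : Type*} [Group G] [TopologicalSpace G] [IsTopologicalGroup G]
  [LocallyCompactSpace G] [MeasurableSpace G] [BorelSpace G]

instance : (rightHaar G).Regular := by unfold rightHaar; infer_instance

instance : (rightHaar G).IsMulRightInvariant := by unfold rightHaar; infer_instance

instance : (rightHaar G).IsOpenPosMeasure :=
  (Homeomorph.inv G).continuous.isOpenPosMeasure_map (Homeomorph.inv G).surjective

lemma integral_rightHaar (f : G → ℝ) :
    ∫ x, f x ∂(rightHaar G) = ∫ x, f x⁻¹ ∂(Measure.haar : Measure G) :=
  integral_map_equiv (MeasurableEquiv.inv G) f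

/-- The convolution of two real functions; see `conv` for complex ones. -/
noncomputable def convReal (f g : G → ℝ) (x : G) : ℝ := ∫ y, f y⁻¹ * g (y * x) ∂(rightHaar G)

lemma conv_ofReal (f g : G → ℝ) (x : G) :
    conv (fun y => (f y : ℂ)) (fun y => (g y : ℂ)) x = (convReal f g x : ℂ) := by
  unfold conv convReal
  rw [← integral_complex_ofReal]
  simp

lemma IsCcNonneg.convReal [T2Space G] {f g : G → ℝ} (hf : IsCcNonneg f) (hg : IsCcNonneg g) :
    IsCcNonneg (convReal f g) := by
  have hfc := hf.continuous
  have hgc := hg.continuous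
  refine IsCcNonneg.of_zero_off (k := tsupport f * tsupport g) ?_ ?_
    (hf.hasCompactSupport.isCompact.mul hg.hasCompactSupport.isCompact) ?_
  · refine continuous_integral_of_zero_off (k := (tsupport f)⁻¹) (by fun_prop)
      hf.hasCompactSupport.isCompact.inv fun x y hy => ?_
    rw [hf.eq_zero (x := y⁻¹) (by simpa using hy), zero_mul]
  · exact fun x => integral_nonneg fun y => mul_nonneg (hf.nonneg _) (hg.nonneg _)
  · intro x hx
    refine integral_eq_zero_of_ae (ae_of_all _ fun y => ?_)
    by_contra h
    have h1 : y⁻¹ ∈ tsupport f := by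
      by_contra h1; exact h (by simp [hf.eq_zero h1])
    have h2 : y * x ∈ tsupport g := by
      by_contra h1; exact h (by simp [hg.eq_zero h1])
    exact hx (by simpa using Set.mul_mem_mul h1 h2)

/-- A continuous automorphism scales the right Haar integral. -/
lemma exists_integral_comp_continuousMulEquiv (φ : G ≃ₜ* G) :
    ∃ δ : ℝ, 0 < δ ∧ ∀ f : G → ℝ,
      ∫ x, f (φ x) ∂(rightHaar G) = δ * ∫ x, f x ∂(rightHaar G) := by
  have hpos := mulEquivHaarChar_pos φ
  refine ⟨(mulEquivHaarChar φ : ℝ)⁻¹, by positivity, fun f => ?_⟩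
  have h := mulEquivHaarChar_smul_integral_map (Measure.haar : Measure G)
    (f := fun x => f x⁻¹) φ
  rw [integral_rightHaar, integral_rightHaar, ← h, NNReal.smul_def, smul_eq_mul,
    inv_mul_cancel_left₀ (by exact_mod_cast hpos.ne')]
  have := integral_map_equiv (μ := (Measure.haar : Measure G)) φ.toHomeomorph.toMeasurableEquiv
    (fun x => f x⁻¹)
  refine Eq.trans ?_ this.symm
  refine integral_congr_ae (ae_of_all _ fun x => ?_)
  show f (φ x⁻¹) = f (φ x)⁻¹
  rw [map_inv]

end Conv

/-! ### Property RD for nonnegative functions -/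

section RDBound

variable {G : Type*} [Group G] [TopologicalSpace G] [IsTopologicalGroup G]
  [LocallyCompactSpace G] [MeasurableSpace G] [BorelSpace G]

/-- The `L²` norm of a real function for right Haar measure, as a real number; it is only
meaningful for square-integrable functions. -/
noncomputable def l2norm (f : G → ℝ) : ℝ := √(∫ x, f x ^ 2 ∂(rightHaar G))

lemma l2norm_nonneg (f : G → ℝ) : 0 ≤ l2norm f := Real.sqrt_nonneg _

lemma l2norm_sq (f : G → ℝ) : l2norm f ^ 2 = ∫ x, f x ^ 2 ∂(rightHaar G) :=
  Real.sq_sqrt (integral_nonneg fun _ => sq_nonneg _)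

lemma eLpNorm_eq_ofReal_l2norm {E : Type*} [NormedAddCommGroup E] {f : G → E}
    (hf : MemLp f 2 (rightHaar G)) :
    eLpNorm f 2 (rightHaar G) = ENNReal.ofReal (l2norm fun x => ‖f x‖) := by
  rw [hf.eLpNorm_eq_integral_rpow_norm (by simp) (by simp)]
  simp [l2norm, Real.sqrt_eq_rpow]

lemma IsCcNonneg.eLpNorm_eq {f : G → ℝ} (hf : IsCcNonneg f) :
    eLpNorm (fun x => (f x : ℂ)) 2 (rightHaar G) = ENNReal.ofReal (l2norm f) := by
  rw [eLpNorm_eq_ofReal_l2norm ((hf.memLp 2).ofReal)]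
  simp [abs_of_nonneg (hf.nonneg _)]

/-- The estimate of property RD with exponent `s` and constant `C`, for nonnegative functions
in `C_c(G)`. -/
def RDBound (ℓ : G → ℝ) (s C : ℝ) : Prop :=
  ∀ R : ℝ, 0 ≤ R → ∀ f g : G → ℝ, IsCcNonneg f → IsCcNonneg g → (∀ x, f x ≠ 0 → ℓ x ≤ R) →
    l2norm (convReal f g) ≤ C * (1 + R) ^ s * l2norm f * l2norm g

lemma eLpNorm_conv_le_opNorm_mul {f g : G → ℂ} (hg : MemLp g 2 (rightHaar G)) :
    eLpNorm (conv f g) 2 (rightHaar G) ≤ opNorm f * eLpNorm g 2 (rightHaar G) := by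
  rcases eq_or_ne (eLpNorm g 2 (rightHaar G)) 0 with h0 | h0
  · -- `opNorm f` may be `∞` here, so that the infimum says nothing
    have hg0 : g =ᵐ[rightHaar G] 0 := (eLpNorm_eq_zero_iff hg.1 (by simp)).1 h0
    have hz : conv f g = 0 := by
      ext x
      refine integral_eq_zero_of_ae ?_
      filter_upwards [(measurePreserving_mul_right (rightHaar G) x).quasiMeasurePreserving.ae hg0]
        with y hy
      simp [hy]
    simp [hz]
  · rw [← ENNReal.div_le_iff h0 hg.2.ne]
    exact le_sInf fun c hc => (ENNReal.div_le_iff h0 hg.2.ne).2 (hc g hg)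

lemma HasRDWith.exists_rdBound [T2Space G] {ℓ : G → ℝ} (h : HasRDWith ℓ) :
    ∃ s C : ℝ, 0 < s ∧ 0 < C ∧ RDBound ℓ s C := by
  obtain ⟨s, C, hs, hC, H⟩ := h
  refine ⟨s, C, hs, hC, fun R hR f g hf hg hfR => ?_⟩
  have hfc : HasCompactSupport (fun x => (f x : ℂ)) :=
    hf.hasCompactSupport.comp_left Complex.ofReal_zero
  have h1 := H (fun x => (f x : ℂ)) (Complex.continuous_ofReal.comp hf.continuous) hfc
  have h2 := eLpNorm_conv_le_opNorm_mul (f := fun x => (f x : ℂ)) ((hg.memLp 2).ofReal (K := ℂ))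
  have h3 : supportLength ℓ (fun x => (f x : ℂ)) ≤ ENNReal.ofReal R :=
    iSup₂_le fun x hx => ENNReal.ofReal_le_ofReal (hfR x (by simpa using hx))
  have h4 : (1 + supportLength ℓ (fun x => (f x : ℂ))) ^ s ≤ ENNReal.ofReal ((1 + R) ^ s) := by
    rw [← ENNReal.ofReal_rpow_of_pos (by positivity), ENNReal.ofReal_add zero_le_one hR,
      ENNReal.ofReal_one]
    gcongr
  have h5 : conv (fun x => (f x : ℂ)) (fun x => (g x : ℂ)) = fun x => (convReal f g x : ℂ) :=
    funext (conv_ofReal f g)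
  change eLpNorm (conv (fun x => (f x : ℂ)) (fun x => (g x : ℂ))) 2 _ ≤
    _ * eLpNorm (fun x => (g x : ℂ)) 2 _ at h2
  rw [h5, (hf.convReal hg).eLpNorm_eq, hg.eLpNorm_eq] at h2
  rw [hf.eLpNorm_eq] at h1
  have h6 : ENNReal.ofReal (l2norm (convReal f g)) ≤
      ENNReal.ofReal (C * (1 + R) ^ s * l2norm f * l2norm g) := by
    rw [ENNReal.ofReal_mul (by have := l2norm_nonneg f; positivity),
      ENNReal.ofReal_mul (by positivity), ENNReal.ofReal_mul hC.le]
    refine h2.trans ?_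
    gcongr
    refine h1.trans ?_
    gcongr
  have := l2norm_nonneg f
  have := l2norm_nonneg g
  exact (ENNReal.ofReal_le_ofReal_iff (by positivity)).1 h6

lemma continuous_conv {f g : G → ℂ} (hf : Continuous f) (hfc : HasCompactSupport f)
    (hg : Continuous g) : Continuous (conv f g) := by
  refine continuous_integral_of_zero_off (k := (tsupport f)⁻¹) (by fun_prop)
    hfc.isCompact.inv fun x y hy => ?_
  rw [image_eq_zero_of_notMem_tsupport (f := f) (x := y⁻¹) (by simpa using hy), zero_mul]

lemma memLp_mul_right {g : G → ℂ} (hg : MemLp g 2 (rightHaar G)) (x : G) :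
    MemLp (fun y => g (y * x)) 2 (rightHaar G) :=
  hg.comp_measurePreserving (measurePreserving_mul_right _ x)

lemma memLp_comp_inv {f : G → ℂ} (hf : Continuous f) (hfc : HasCompactSupport f) :
    MemLp (fun y => f y⁻¹) 2 (rightHaar G) :=
  (hf.comp continuous_inv).memLp_of_hasCompactSupport (hfc.comp_homeomorph (Homeomorph.inv G))

/-- Uniform control of the convolution: Cauchy–Schwarz and right invariance. -/
lemma enorm_conv_sub_conv_le {f g h : G → ℂ} (hf : Continuous f) (hfc : HasCompactSupport f)
    (hg : MemLp g 2 (rightHaar G)) (hh : MemLp h 2 (rightHaar G)) (x : G) :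
    ‖conv f g x - conv f h x‖ₑ ≤
      eLpNorm (fun y => f y⁻¹) 2 (rightHaar G) * eLpNorm (g - h) 2 (rightHaar G) := by
  have hf2 := memLp_comp_inv hf hfc
  have hgx := memLp_mul_right hg x
  have hhx := memLp_mul_right hh x
  have hsub := integral_sub (hf2.integrable_mul hgx) (hf2.integrable_mul hhx)
  simp only [Pi.mul_apply] at hsub
  unfold conv
  rw [← hsub]
  refine (enorm_integral_le_lintegral_enorm _).trans ?_
  rw [← eLpNorm_one_eq_lintegral_enorm]
  have h1 : (fun y => f y⁻¹ * g (y * x) - f y⁻¹ * h (y * x)) =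
      (fun y => f y⁻¹) • (fun y => (g - h) (y * x)) := by
    ext y; simp [mul_sub]
  rw [h1]
  refine (eLpNorm_smul_le_mul_eLpNorm (p := 2) (q := 2) (r := 1)
    (memLp_mul_right (hg.sub hh) x).1 hf2.1).trans ?_
  have h2 := eLpNorm_comp_measurePreserving (p := 2) (hg.sub hh).1
    (measurePreserving_mul_right (rightHaar G) x)
  rw [← h2]
  rfl

lemma RDBound.eLpNorm_conv_le [T2Space G] {ℓ : G → ℝ} {s C : ℝ} (hC : 0 < C)
    (H : RDBound ℓ s C) {R : ℝ}
    (hR : 0 ≤ R) {f g : G → ℂ} (hf : Continuous f) (hfc : HasCompactSupport f)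
    (hg : Continuous g) (hgc : HasCompactSupport g) (hfR : ∀ x, f x ≠ 0 → ℓ x ≤ R) :
    eLpNorm (conv f g) 2 (rightHaar G) ≤ ENNReal.ofReal (C * (1 + R) ^ s) *
      eLpNorm f 2 (rightHaar G) * eLpNorm g 2 (rightHaar G) := by
  have hf' : IsCcNonneg fun x => ‖f x‖ := ⟨hf.norm, hfc.norm, fun x => norm_nonneg _⟩
  have hg' : IsCcNonneg fun x => ‖g x‖ := ⟨hg.norm, hgc.norm, fun x => norm_nonneg _⟩
  have h1 := H R hR _ _ hf' hg' (fun x hx => hfR x (by simpa using hx))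
  have hcv := hf'.convReal hg'
  have h2 : eLpNorm (conv f g) 2 (rightHaar G) ≤
      eLpNorm (fun x => (convReal (fun x => ‖f x‖) (fun x => ‖g x‖) x : ℂ)) 2 (rightHaar G) := by
    refine eLpNorm_mono fun x => ?_
    rw [Complex.norm_real, Real.norm_of_nonneg (hcv.nonneg x)]
    refine (norm_integral_le_integral_norm _).trans_eq ?_
    simp [convReal]
  refine h2.trans ?_
  rw [hcv.eLpNorm_eq, eLpNorm_eq_ofReal_l2norm (hf.memLp_of_hasCompactSupport hfc),
    eLpNorm_eq_ofReal_l2norm (hg.memLp_of_hasCompactSupport hgc),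
    ← ENNReal.ofReal_mul (by positivity),
    ← ENNReal.ofReal_mul (mul_nonneg (by positivity) (l2norm_nonneg _))]
  exact ENNReal.ofReal_le_ofReal h1

/-- It suffices to test the operator norm of `T_f` on `C_c(G)`, by density and Fatou's lemma. -/
lemma opNorm_le_of_forall_hasCompactSupport [NormalSpace G] {f : G → ℂ} (hf : Continuous f)
    (hfc : HasCompactSupport f) {K : ℝ≥0∞} (hK : K ≠ ∞)
    (H : ∀ g : G → ℂ, Continuous g → HasCompactSupport g →
      eLpNorm (conv f g) 2 (rightHaar G) ≤ K * eLpNorm g 2 (rightHaar G)) : opNorm f ≤ K := by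
  refine sInf_le fun g hg => ?_
  have hε : ∀ n : ℕ, (n + 1 : ℝ≥0∞)⁻¹ ≠ 0 := fun n => by simp
  choose h hhc hhle hhcont hhL using fun n : ℕ =>
    hg.exists_hasCompactSupport_eLpNorm_sub_le (by simp) (hε n)
  have hlim0 : Tendsto (fun n : ℕ => (n + 1 : ℝ≥0∞)⁻¹) atTop (𝓝 0) := by
    have := (tendsto_add_atTop_iff_nat 1).2 ENNReal.tendsto_inv_nat_nhds_zero
    simpa using this
  have hlim : ∀ x, Tendsto (fun n => conv f (h n) x) atTop (𝓝 (conv f g x)) := by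
    intro x
    rw [tendsto_iff_edist_tendsto_0]
    have hA := (memLp_comp_inv hf hfc).2.ne
    have := ENNReal.Tendsto.const_mul (a := eLpNorm (fun y => f y⁻¹) 2 (rightHaar G)) hlim0
      (Or.inr hA)
    rw [mul_zero] at this
    refine tendsto_of_tendsto_of_tendsto_of_le_of_le tendsto_const_nhds this
      (fun _ => zero_le) fun n => ?_
    dsimp only
    rw [edist_comm, edist_eq_enorm_sub]
    refine (enorm_conv_sub_conv_le hf hfc hg (hhL n) x).trans ?_
    gcongr
    exact hhle n
  have hbd : ∀ n, eLpNorm (conv f (h n)) 2 (rightHaar G) ≤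
      K * (eLpNorm g 2 (rightHaar G) + (n + 1 : ℝ≥0∞)⁻¹) := by
    intro n
    refine (H _ (hhcont n) (hhc n)).trans ?_
    gcongr
    calc eLpNorm (h n) 2 (rightHaar G) = eLpNorm (g - (g - h n)) 2 (rightHaar G) := by
          rw [sub_sub_cancel]
      _ ≤ eLpNorm g 2 (rightHaar G) + eLpNorm (g - h n) 2 (rightHaar G) :=
          eLpNorm_sub_le hg.1 (hg.sub (hhL n)).1 (by norm_num)
      _ ≤ _ := by gcongr; exact hhle n
  refine (Lp.eLpNorm_lim_le_liminf_eLpNorm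
    (fun n => (continuous_conv hf hfc (hhcont n)).aestronglyMeasurable) _
    (ae_of_all _ hlim)).trans ?_
  have h3 : Tendsto (fun n : ℕ => K * (eLpNorm g 2 (rightHaar G) + (n + 1 : ℝ≥0∞)⁻¹)) atTop
      (𝓝 (K * eLpNorm g 2 (rightHaar G))) := by
    have := ENNReal.Tendsto.const_mul (a := K)
      ((tendsto_const_nhds (x := eLpNorm g 2 (rightHaar G))).add hlim0) (Or.inr hK)
    simpa using this
  rw [← h3.liminf_eq]
  exact liminf_le_liminf (Eventually.of_forall hbd)

lemma RDBound.hasRDWith [T2Space G] [NormalSpace G] {ℓ : G → ℝ} {s C : ℝ} (hs : 0 < s) (hC : 0 < C)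
    (H : RDBound ℓ s C) : HasRDWith ℓ := by
  refine ⟨s, C, hs, hC, fun f hf hfc => ?_⟩
  have hf2 : MemLp f 2 (rightHaar G) := hf.memLp_of_hasCompactSupport hfc
  by_cases htop : supportLength ℓ f = ∞
  · -- an infinite support length is harmless: the right-hand side is then infinite
    have hne : eLpNorm f 2 (rightHaar G) ≠ 0 := by
      intro h0
      rw [eLpNorm_eq_zero_iff hf2.1 (by simp)] at h0
      have : f = 0 := (Continuous.ae_eq_iff_eq _ hf continuous_const).1 h0
      simp [this, supportLength] at htop
    rw [htop, add_top, ENNReal.top_rpow_of_pos hs, ENNReal.mul_top (by simpa using hC),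
      ENNReal.top_mul hne]
    exact le_top
  · set R := (supportLength ℓ f).toReal with hRdef
    have hR : 0 ≤ R := ENNReal.toReal_nonneg
    have hfR : ∀ x, f x ≠ 0 → ℓ x ≤ R := fun x hx =>
      (ENNReal.ofReal_le_iff_le_toReal htop).1
        (le_iSup₂ (f := fun x (_ : x ∈ Function.support f) => ENNReal.ofReal (ℓ x)) x hx)
    have h1 : ENNReal.ofReal C * (1 + supportLength ℓ f) ^ s =
        ENNReal.ofReal (C * (1 + R) ^ s) := by
      rw [ENNReal.ofReal_mul hC.le, ← ENNReal.ofReal_rpow_of_pos (by positivity),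
        ENNReal.ofReal_add zero_le_one hR, ENNReal.ofReal_one, ENNReal.ofReal_toReal htop]
    rw [h1]
    exact opNorm_le_of_forall_hasCompactSupport hf hfc
      (ENNReal.mul_ne_top ENNReal.ofReal_ne_top hf2.2.ne)
      fun g hg hgc => H.eLpNorm_conv_le hC hR hf hfc hg hgc hfR

/-- Property RD passes to larger lengths. -/
lemma RDBound.of_le {ℓ ℓ' : G → ℝ} {s C M : ℝ} (hs : 0 < s) (hC : 0 < C) (hM : 0 ≤ M)
    (hle : ∀ x, ℓ x ≤ M * ℓ' x) (H : RDBound ℓ s C) : RDBound ℓ' s (C * (1 + M) ^ s) := by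
  intro R hR f g hf hg hfR
  refine (H (M * R) (by positivity) f g hf hg fun x hx =>
    (hle x).trans (mul_le_mul_of_nonneg_left (hfR x hx) hM)).trans ?_
  have h : (1 + M * R) ^ s ≤ (1 + M) ^ s * (1 + R) ^ s := by
    rw [← Real.mul_rpow (by positivity) (by positivity)]
    gcongr
    nlinarith
  have h0 := l2norm_nonneg f
  have h1 := l2norm_nonneg g
  rw [mul_assoc C ((1 + M) ^ s)]
  gcongr

end RDBound

/-! ### Lengths and word-lengths -/

section Lengths

variable {G : Type*} [Group G]

lemma exists_mem_pow_of_closure_eq_top {S : Set G} (hS : Subgroup.closure S = ⊤) (x : G) :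
    ∃ n : ℕ, x ∈ (S ∪ S⁻¹) ^ n := by
  have hx : x ∈ (Subgroup.closure S).toSubmonoid := by rw [hS]; trivial
  rw [Subgroup.closure_toSubmonoid] at hx
  induction hx using Submonoid.closure_induction with
  | mem x hx => exact ⟨1, by simpa using hx⟩
  | one => exact ⟨0, by simp⟩
  | mul x y _ _ hx hy =>
    obtain ⟨m, hm⟩ := hx
    obtain ⟨n, hn⟩ := hy
    exact ⟨m + n, by rw [pow_add]; exact Set.mul_mem_mul hm hn⟩

lemma IsLength.le_mul_of_mem_pow [MeasurableSpace G] {L : G → ℝ} (hL : IsLength L) {T : Set G}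
    {M : ℝ} (hT : ∀ y ∈ T, L y ≤ M) {n : ℕ} {x : G} (hx : x ∈ T ^ n) : L x ≤ n * M := by
  induction n generalizing x with
  | zero =>
    rw [pow_zero, Set.mem_one] at hx
    simp [hx, hL.map_one]
  | succ n ih =>
    rw [pow_succ] at hx
    obtain ⟨a, ha, b, hb, rfl⟩ := hx
    have := hL.map_mul_le a b
    have := ih ha
    have := hT b hb
    push_cast
    linarith

variable [TopologicalSpace G]

lemma IsCompactlyGenerated.sigmaCompactSpace [IsTopologicalGroup G]
    (h : IsCompactlyGenerated G) : SigmaCompactSpace G := by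
  obtain ⟨K, hK, hgen⟩ := h
  have hpow : ∀ n : ℕ, IsCompact ((K ∪ K⁻¹) ^ n) := fun n => by
    induction n with
    | zero => simp
    | succ n ih => rw [pow_succ]; exact ih.mul (hK.union hK.inv)
  refine ⟨fun n => (K ∪ K⁻¹) ^ n, hpow, ?_⟩
  exact Set.eq_univ_of_forall fun x => Set.mem_iUnion.2 (exists_mem_pow_of_closure_eq_top hgen x)

lemma IsLength.comp_monoidHom {H : Type*} [Group H] [TopologicalSpace H] [MeasurableSpace H]
    [BorelSpace H] [MeasurableSpace G] [BorelSpace G] {L : G → ℝ} (hL : IsLength L)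
    {φ : H →* G} (hφ : Continuous φ) : IsLength fun x => L (φ x) where
  measurable := hL.measurable.comp hφ.measurable
  nonneg _ := hL.nonneg _
  map_one := by rw [_root_.map_one, hL.map_one]
  map_inv x := by rw [_root_.map_inv, hL.map_inv]
  map_mul_le x y := by rw [map_mul]; exact hL.map_mul_le _ _

variable [IsTopologicalGroup G] [LocallyCompactSpace G] [MeasurableSpace G] [BorelSpace G]

/-- A Borel length is bounded on a set of positive finite measure, hence near the identity by
Steinhaus' theorem. -/
lemma IsLength.exists_eventually_le {L : G → ℝ} (hL : IsLength L) :
    ∃ M : ℝ, ∀ᶠ x in 𝓝 (1 : G), L x ≤ M := by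
  obtain ⟨K, hK, hK1⟩ := exists_compact_mem_nhds (1 : G)
  set μ : Measure G := Measure.haar
  have hU : ⋃ n : ℕ, interior K ∩ {x | L x ≤ n} = interior K := by
    rw [← Set.inter_iUnion, Set.inter_eq_left]
    intro x _
    obtain ⟨n, hn⟩ := exists_nat_ge (L x)
    exact Set.mem_iUnion.2 ⟨n, hn⟩
  obtain ⟨n, hn⟩ : ∃ n : ℕ, μ (interior K ∩ {x | L x ≤ n}) ≠ 0 := by
    by_contra! h
    have h0 := measure_iUnion_null h
    rw [hU] at h0
    exact isOpen_interior.measure_ne_zero μ ⟨1, mem_interior_iff_mem_nhds.2 hK1⟩ h0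
  have hE := Measure.div_mem_nhds_one_of_haar_pos_ne_top μ (interior K ∩ {x | L x ≤ n})
    (isOpen_interior.measurableSet.inter (measurableSet_le hL.measurable measurable_const))
    (pos_iff_ne_zero.2 hn)
    ((measure_mono (Set.inter_subset_left.trans interior_subset)).trans_lt
      hK.measure_lt_top).ne
  refine ⟨n + n, mem_of_superset hE ?_⟩
  rintro _ ⟨a, ⟨-, ha⟩, b, ⟨-, hb⟩, rfl⟩
  have := hL.map_mul_le a b⁻¹
  rw [hL.map_inv, ← div_eq_mul_inv] at this
  exact this.trans (add_le_add ha hb)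

lemma IsLength.exists_bound_of_isCompact {L : G → ℝ} (hL : IsLength L) {K : Set G}
    (hK : IsCompact K) : ∃ M : ℝ, ∀ x ∈ K, L x ≤ M := by
  obtain ⟨M, hM⟩ := hL.exists_eventually_le
  refine hK.induction_on (p := fun s => ∃ M : ℝ, ∀ x ∈ s, L x ≤ M) ⟨0, by simp⟩ ?_ ?_ ?_
  · rintro s t hst ⟨M, hM⟩
    exact ⟨M, fun x hx => hM x (hst hx)⟩
  · rintro s t ⟨M, hM⟩ ⟨M', hM'⟩
    refine ⟨max M M', fun x hx => ?_⟩
    rcases hx with hx | hx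
    · exact (hM x hx).trans (le_max_left _ _)
    · exact (hM' x hx).trans (le_max_right _ _)
  · intro x _
    refine ⟨{y | L (x⁻¹ * y) ≤ M}, mem_nhdsWithin_of_mem_nhds ?_, L x + M, fun y hy => ?_⟩
    · have ht : Tendsto (fun y => x⁻¹ * y) (𝓝 x) (𝓝 1) := by
        have h : ContinuousAt (fun y => x⁻¹ * y) x := by fun_prop
        simpa [ContinuousAt] using h
      exact ht.eventually hM
    · have h := hL.map_mul_le x (x⁻¹ * y)
      rw [mul_inv_cancel_left] at h
      exact h.trans (add_le_add le_rfl hy)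

/-- Every length is dominated by every word-length. -/
lemma IsLength.exists_le_mul_wordLength {L ℓ : G → ℝ} (hL : IsLength L) (hℓ : IsWordLength ℓ) :
    ∃ M : ℝ, 0 ≤ M ∧ ∀ x, L x ≤ M * ℓ x := by
  obtain ⟨-, S, hS, hgen, rfl⟩ := hℓ
  obtain ⟨M, hM⟩ := hL.exists_bound_of_isCompact hS
  refine ⟨max M 0, le_max_right _ _, fun x => ?_⟩
  rw [mul_comm]
  refine hL.le_mul_of_mem_pow (T := S ∪ S⁻¹) ?_
    (Nat.sInf_mem (exists_mem_pow_of_closure_eq_top hgen x))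
  rintro y (hy | hy)
  · exact (hM y (subset_closure hy)).trans (le_max_left _ _)
  · rw [← hL.map_inv]
    exact (hM _ (subset_closure hy)).trans (le_max_left _ _)

end Lengths

/-! ### Cosets of the kernel of an extension -/

section Fiber

variable {N G Q : Type*} [Group N] [TopologicalSpace N]
  [Group G] [TopologicalSpace G] [IsTopologicalGroup G] [Group Q] [TopologicalSpace Q]
  {ι : N →* G} {π : G →* Q}

/-- Conjugation by an element of `G`, as an automorphism of the kernel `N`. -/
lemma exists_continuousMulEquiv_conj (H : TopologicalGroup.IsSES ι π) (y : G) :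
    ∃ α : N ≃ₜ* N, ∀ n, ι (α n) = y * ι n * y⁻¹ := by
  have hex : ∀ (z : G) (n : N), ∃ m, ι m = z * ι n * z⁻¹ := fun z n =>
    (H.mulExact _).1 (by simp [H.mulExact.apply_apply_eq_one])
  choose A hA using hex
  have hinj := H.isClosedEmbedding.injective
  have hcont : ∀ z, Continuous (A z) := fun z => by
    rw [H.isClosedEmbedding.isInducing.continuous_iff]
    have : ι ∘ A z = fun n => z * ι n * z⁻¹ := funext (hA z)
    rw [this]
    have := H.isClosedEmbedding.continuous
    fun_prop
  exact ⟨{  toFun := A y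
            invFun := A y⁻¹
            left_inv := fun n => hinj (by simp [hA, mul_assoc])
            right_inv := fun n => hinj (by simp [hA, mul_assoc])
            map_mul' := fun m n => hinj (by simp [hA, mul_assoc])
            continuous_toFun := hcont y
            continuous_invFun := hcont y⁻¹ }, hA y⟩

lemma IsCcNonneg.fiber_mul_right (H : TopologicalGroup.IsSES ι π) {k : G → ℝ} (hk : IsCcNonneg k)
    (x : G) : IsCcNonneg fun n => k (ι n * x) :=
  hk.comp_isClosedEmbedding ((Homeomorph.mulRight x).isClosedEmbedding.comp H.isClosedEmbedding)

lemma IsCcNonneg.fiber_mul_left (H : TopologicalGroup.IsSES ι π) {k : G → ℝ} (hk : IsCcNonneg k)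
    (x : G) : IsCcNonneg fun n => k (x * ι n) :=
  hk.comp_isClosedEmbedding ((Homeomorph.mulLeft x).isClosedEmbedding.comp H.isClosedEmbedding)

variable [IsTopologicalGroup N] [LocallyCompactSpace N] [T2Space N] [MeasurableSpace N]
  [BorelSpace N] [MeasurableSpace G]

/-- The contribution to `⟨u, f * g⟩` of one pair of cosets of `N`. Conjugation by `y` need not
preserve the Haar measure of `N`, but passing from the functions `n ↦ f (y⁻¹ n)` and
`n ↦ g (n y x)` on `N` to the restrictions of `f` and of `f * g` to cosets scales both `L²` norms
by the same factor, so that no modular function survives. -/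
lemma RDBound.integral_fiber_le (H : TopologicalGroup.IsSES ι π) {ℓ : G → ℝ} (hℓ : IsLength ℓ)
    {s C : ℝ} (HN : RDBound (fun n : N => ℓ (ι n)) s C) {R : ℝ} (hR : 0 ≤ R)
    {f g u : G → ℝ} (hf : IsCcNonneg f) (hg : IsCcNonneg g) (hu : IsCcNonneg u)
    (hfR : ∀ x, f x ≠ 0 → ℓ x ≤ R) (x y : G) (hy : f y⁻¹ ≠ 0) :
    ∫ n, f (ι n * y)⁻¹ * ∫ m, u (ι m * x) * g (ι n * y * (ι m * x)) ∂(rightHaar N)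
      ∂(rightHaar N) ≤
    C * (1 + 2 * R) ^ s * l2norm (fun m => u (ι m * x)) *
      (l2norm (fun m => f (ι m * y⁻¹)) * l2norm fun m => g (ι m * (y * x))) := by
  obtain ⟨α, hα⟩ := exists_continuousMulEquiv_conj H y
  obtain ⟨δ, hδ, hδint⟩ := exists_integral_comp_continuousMulEquiv α
  have hscale : ∀ h : N → ℝ, l2norm (fun m => h (α m)) = √δ * l2norm h := fun h => by
    rw [l2norm, hδint fun m => h m ^ 2, Real.sqrt_mul hδ.le, l2norm]
  have hιc := H.isClosedEmbedding.continuous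
  set a : N → ℝ := fun n => f (y⁻¹ * ι n) with ha_def
  set b : N → ℝ := fun m => g (ι m * (y * x)) with hb_def
  set v : N → ℝ := fun m => u (ι m * x) with hv_def
  have ha : IsCcNonneg a := hf.fiber_mul_left H y⁻¹
  have hb : IsCcNonneg b := hg.fiber_mul_right H (y * x)
  have hv : IsCcNonneg v := hu.fiber_mul_right H x
  have hab : IsCcNonneg fun m => convReal a b (α m) :=
    (ha.convReal hb).comp_isClosedEmbedding α.toHomeomorph.isClosedEmbedding
  have haα : l2norm (fun m => f (ι m * y⁻¹)) = √δ * l2norm a := by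
    rw [← hscale]
    congr 1
    ext m
    simp [ha_def, hα, mul_assoc]
  -- `N` meets the support of `f (y⁻¹ ·)` within length `2R`
  have hRD : l2norm (convReal a b) ≤ C * (1 + 2 * R) ^ s * l2norm a * l2norm b := by
    refine HN (2 * R) (by positivity) a b ha hb fun n hn => ?_
    have h1 := hℓ.map_mul_le y (y⁻¹ * ι n)
    have h2 := hfR _ hn
    have h3 := hfR _ hy
    rw [hℓ.map_inv] at h3
    rw [mul_inv_cancel_left] at h1
    linarith
  have hswap : ∫ n, f (ι n * y)⁻¹ * ∫ m, u (ι m * x) * g (ι n * y * (ι m * x)) ∂(rightHaar N)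
      ∂(rightHaar N) = ∫ m, v m * convReal a b (α m) ∂(rightHaar N) := by
    have hac := ha.continuous
    have hbc := hb.continuous
    have hvc := hv.continuous
    have hαc : Continuous α := α.continuous_toFun
    have h := integral_integral_swap_of_zero_off (μ := rightHaar N) (ν := rightHaar N)
      (F := fun n m => a n⁻¹ * (v m * b (n * α m))) (by fun_prop)
      ha.hasCompactSupport.isCompact.inv hv.hasCompactSupport.isCompact
      (fun n m hn => by rw [ha.eq_zero (x := n⁻¹) (by simpa using hn), zero_mul])
      (fun n m hm => by rw [hv.eq_zero hm, zero_mul, mul_zero])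
    calc _ = ∫ n, ∫ m, a n⁻¹ * (v m * b (n * α m)) ∂(rightHaar N) ∂(rightHaar N) := by
          refine integral_congr_ae (ae_of_all _ fun n => ?_)
          dsimp only
          rw [← integral_const_mul]
          refine integral_congr_ae (ae_of_all _ fun m => ?_)
          simp [ha_def, hb_def, hv_def, hα, mul_assoc]
      _ = _ := h
      _ = _ := by
          refine integral_congr_ae (ae_of_all _ fun m => ?_)
          dsimp only [convReal]
          rw [← integral_const_mul]
          refine integral_congr_ae (ae_of_all _ fun n => ?_)
          dsimp only
          ring
  rw [hswap, haα]
  calc _ ≤ l2norm v * l2norm fun m => convReal a b (α m) := integral_mul_le_sqrt_mul_sqrt hv hab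
    _ = l2norm v * (√δ * l2norm (convReal a b)) := by rw [hscale]
    _ ≤ l2norm v * (√δ * (C * (1 + 2 * R) ^ s * l2norm a * l2norm b)) := by
        have := l2norm_nonneg v
        gcongr
    _ = _ := by ring

end Fiber

/-! ### Property RD of an extension -/

section Extension

variable {N G Q : Type*}
  [Group N] [TopologicalSpace N] [IsTopologicalGroup N] [LocallyCompactSpace N]
  [MeasurableSpace N] [BorelSpace N]
  [Group G] [TopologicalSpace G] [IsTopologicalGroup G] [LocallyCompactSpace G] [T2Space G]
  [MeasurableSpace G] [BorelSpace G]
  [Group Q] [TopologicalSpace Q] [IsTopologicalGroup Q] [LocallyCompactSpace Q]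
  [MeasurableSpace Q] [BorelSpace Q]
  {ι : N →* G} {π : G →* Q}

/-- Weil's formula for right Haar measures: up to a constant coming from the normalisations,
`∫_G k = ∫_Q ∫_N k(n x) dn d(Nx)`. -/
lemma exists_integral_eq_mul_integral_fiber (H : TopologicalGroup.IsSES ι π) :
    ∃ c : ℝ, 0 < c ∧ ∀ k : G → ℝ, IsCcNonneg k → ∃ K : Q → ℝ, IsCcNonneg K ∧
      (∀ x, K (π x) = ∫ n, k (ι n * x) ∂(rightHaar N)) ∧
      ∫ x, k x ∂(rightHaar G) = c * ∫ q, K q ∂(rightHaar Q) := by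
  set μ := H.inducedMeasure (Measure.haar : Measure N) (Measure.haar : Measure Q)
  refine ⟨Measure.haarScalarFactor (Measure.haar : Measure G) μ,
    Measure.haarScalarFactor_pos_of_isHaarMeasure _ _, fun k hk => ?_⟩
  -- `inducedMeasure` is a left Haar measure, hence the inversions
  let k' : CompactlySupportedContinuousMap G ℝ :=
    ⟨⟨fun x => k x⁻¹, hk.continuous.comp continuous_inv⟩,
      hk.hasCompactSupport.comp_homeomorph (Homeomorph.inv G)⟩
  let P := H.pushforward (Measure.haar : Measure N) k'
  have hP : ∀ x, P (π x)⁻¹ = ∫ n, k (ι n * x) ∂(rightHaar N) := by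
    intro x
    rw [← map_inv, integral_rightHaar]
    refine (H.pushforward_apply_apply (Measure.haar : Measure N) k' x⁻¹).trans ?_
    refine integral_congr_ae (ae_of_all _ fun n => ?_)
    show k (x⁻¹ * ι n)⁻¹ = k (ι n⁻¹ * x)
    simp
  refine ⟨fun q => P q⁻¹, ⟨P.continuous.comp continuous_inv,
    P.hasCompactSupport.comp_homeomorph (Homeomorph.inv Q), fun q => ?_⟩, hP, ?_⟩
  · obtain ⟨x, rfl⟩ := H.isOpenQuotientMap.surjective q
    rw [hP]
    exact integral_nonneg fun n => hk.nonneg _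
  · have h := congrArg (fun m => ∫ x, k x⁻¹ ∂m)
      (Measure.isMulLeftInvariant_eq_smul_of_regular (Measure.haar : Measure G) μ)
    simp only [integral_smul_nnreal_measure] at h
    rw [integral_rightHaar, integral_rightHaar]
    simp only [inv_inv]
    rw [h, NNReal.smul_def, smul_eq_mul]
    congr 1
    exact H.integral_inducedMeasure (Measure.haar : Measure N) (Measure.haar : Measure Q) k'

variable [T2Space N] [T2Space Q]

/-- The `L²` norm of a convolution on one coset of `N` is dominated by the convolution on `Q` of
the `L²` norms on cosets. -/
lemma RDBound.l2norm_fiber_convReal_le (H : TopologicalGroup.IsSES ι π) {ℓ : G → ℝ}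
    (hℓ : IsLength ℓ) {s C c : ℝ} (hC : 0 ≤ C) (hc : 0 < c)
    (HN : RDBound (fun n : N => ℓ (ι n)) s C)
    (hWeil : ∀ k : G → ℝ, IsCcNonneg k → ∃ K : Q → ℝ, IsCcNonneg K ∧
      (∀ x, K (π x) = ∫ n, k (ι n * x) ∂(rightHaar N)) ∧
      ∫ x, k x ∂(rightHaar G) = c * ∫ q, K q ∂(rightHaar Q))
    {R : ℝ} (hR : 0 ≤ R) {f g : G → ℝ} (hf : IsCcNonneg f) (hg : IsCcNonneg g)
    (hfR : ∀ x, f x ≠ 0 → ℓ x ≤ R) {F' G' : Q → ℝ} (hF' : IsCcNonneg F') (hG' : IsCcNonneg G')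
    (hFf : ∀ x, F' (π x) = l2norm fun n => f (ι n * x))
    (hGg : ∀ x, G' (π x) = l2norm fun n => g (ι n * x)) (x : G) :
    l2norm (fun n => convReal f g (ι n * x)) ≤
      c * (C * (1 + 2 * R) ^ s) * convReal F' G' (π x) := by
  have hfc := hf.continuous
  have hgc := hg.continuous
  have hιc := H.isClosedEmbedding.continuous
  have hu := hf.convReal hg
  obtain ⟨u, hu_def⟩ : ∃ u, u = convReal f g := ⟨_, rfl⟩
  rw [← hu_def] at hu ⊢
  have huc := hu.continuous
  have hv : IsCcNonneg fun m => u (ι m * x) := hu.fiber_mul_right H x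
  have hvc := hv.continuous
  set a := l2norm fun m => u (ι m * x) with ha_def
  have ha : 0 ≤ a := l2norm_nonneg _
  set KN := C * (1 + 2 * R) ^ s with hKN_def
  have hKN : 0 ≤ KN := by positivity
  have hk : IsCcNonneg fun y =>
      f y⁻¹ * ∫ m, u (ι m * x) * g (y * (ι m * x)) ∂(rightHaar N) := by
    refine IsCcNonneg.of_zero_off ?_ ?_ hf.hasCompactSupport.isCompact.inv ?_
    · refine (hfc.comp continuous_inv).mul (continuous_integral_of_zero_off (by fun_prop)
        hv.hasCompactSupport.isCompact fun y m hm => ?_)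
      have := hv.eq_zero hm
      rw [this, zero_mul]
    · exact fun y => mul_nonneg (hf.nonneg _) (integral_nonneg fun m =>
        mul_nonneg (hu.nonneg _) (hg.nonneg _))
    · intro y hy
      rw [hf.eq_zero (x := y⁻¹) (by simpa using hy), zero_mul]
  obtain ⟨K, hK, hKfib, hKint⟩ := hWeil _ hk
  have hKle : ∀ q, K q ≤ KN * a * (F' q⁻¹ * G' (q * π x)) := by
    intro q
    by_cases hq : ∃ y, π y = q ∧ f y⁻¹ ≠ 0
    · obtain ⟨y, rfl, hy⟩ := hq
      rw [hKfib, ← map_inv, ← map_mul, hFf, hGg]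
      exact HN.integral_fiber_le H hℓ hR hf hg hu hfR x y hy
    · push Not at hq
      obtain ⟨y, rfl⟩ := H.isOpenQuotientMap.surjective q
      have h0 : ∀ n, f (ι n * y)⁻¹ = 0 := fun n =>
        hq _ (by rw [map_mul, H.mulExact.apply_apply_eq_one, one_mul])
      rw [hKfib]
      simp only [h0, zero_mul, integral_zero]
      exact mul_nonneg (mul_nonneg hKN ha) (mul_nonneg (hF'.nonneg _) (hG'.nonneg _))
  have hsq : a ^ 2 = c * ∫ q, K q ∂(rightHaar Q) := by
    rw [← hKint, ha_def, l2norm_sq]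
    have h := integral_integral_swap_of_zero_off (μ := rightHaar N) (ν := rightHaar G)
      (F := fun m y => f y⁻¹ * (u (ι m * x) * g (y * (ι m * x)))) (by fun_prop)
      hv.hasCompactSupport.isCompact hf.hasCompactSupport.isCompact.inv
      (fun m y hm => by
        have := hv.eq_zero hm
        rw [this, zero_mul, mul_zero])
      (fun m y hy => by rw [hf.eq_zero (x := y⁻¹) (by simpa using hy), zero_mul])
    calc _ = _ := by
          refine integral_congr_ae (ae_of_all _ fun m => ?_)
          dsimp only
          rw [pow_two]
          nth_rewrite 2 [hu_def]
          unfold convReal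
          rw [← integral_const_mul]
          refine integral_congr_ae (ae_of_all _ fun y => ?_)
          exact mul_left_comm _ _ _
      _ = _ := h
      _ = _ := by simp only [integral_const_mul]
  have hle : ∫ q, K q ∂(rightHaar Q) ≤ KN * a * convReal F' G' (π x) := by
    unfold convReal
    rw [← integral_const_mul]
    refine integral_mono hK.integrable (Integrable.const_mul ?_ _) hKle
    have hFi : IsCcNonneg fun q => F' q⁻¹ :=
      hF'.comp_isClosedEmbedding (Homeomorph.inv Q).isClosedEmbedding
    have hGi : IsCcNonneg fun q => G' (q * π x) :=
      hG'.comp_isClosedEmbedding (Homeomorph.mulRight (π x)).isClosedEmbedding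
    exact (hFi.mul hGi).integrable
  rcases ha.eq_or_lt with h0 | h0
  · rw [← h0]
    exact mul_nonneg (mul_nonneg hc.le hKN) ((hF'.convReal hG').nonneg _)
  · refine le_of_mul_le_mul_right ?_ h0
    calc a * a = c * ∫ q, K q ∂(rightHaar Q) := by rw [← hsq, pow_two]
      _ ≤ c * (KN * a * convReal F' G' (π x)) := by gcongr
      _ = _ := by ring

/-- Property RD of the quotient and of the kernel, the latter for the restricted length, gives
property RD of the extension. -/
theorem RDBound.extension (H : TopologicalGroup.IsSES ι π) {ℓ : G → ℝ} (hℓ : IsLength ℓ)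
    {ℓQ : Q → ℝ} {s C t D M : ℝ} (hs : 0 < s) (hC : 0 < C) (ht : 0 < t) (hD : 0 < D) (hM : 0 ≤ M)
    (hle : ∀ x, ℓQ (π x) ≤ M * ℓ x) (HN : RDBound (fun n : N => ℓ (ι n)) s C)
    (HQ : RDBound ℓQ t D) : ∃ E : ℝ, 0 < E ∧ RDBound ℓ (s + t) E := by
  obtain ⟨c, hc, hWeil⟩ := exists_integral_eq_mul_integral_fiber H
  refine ⟨√c * (C * 2 ^ s) * (D * (1 + M) ^ t), by positivity, fun R hR f g hf hg hfR => ?_⟩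
  -- the function on `Q` formed by the `L²` norms on the cosets of `N`
  have hfib : ∀ k : G → ℝ, IsCcNonneg k → ∃ K : Q → ℝ, IsCcNonneg K ∧
      (∀ x, K (π x) = l2norm fun n => k (ι n * x)) ∧ l2norm k = √c * l2norm K := by
    intro k hk
    obtain ⟨K, hK, hKfib, hKint⟩ := hWeil _ hk.sq
    refine ⟨fun q => √(K q), hK.sqrt, fun x => by dsimp only; rw [hKfib, l2norm], ?_⟩
    rw [l2norm, hKint, Real.sqrt_mul hc.le, l2norm]
    simp only [Real.sq_sqrt (hK.nonneg _)]
  obtain ⟨F', hF', hFf, hFn⟩ := hfib f hf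
  obtain ⟨G', hG', hGg, hGn⟩ := hfib g hg
  obtain ⟨U, hU, hUu, hUn⟩ := hfib _ (hf.convReal hg)
  have hUle : ∀ q, U q ≤ c * (C * (1 + 2 * R) ^ s) * convReal F' G' q := by
    intro q
    obtain ⟨x, rfl⟩ := H.isOpenQuotientMap.surjective q
    rw [hUu]
    exact HN.l2norm_fiber_convReal_le H hℓ hC.le hc hWeil hR hf hg hfR hF' hG' hFf hGg x
  have hFR : ∀ q, F' q ≠ 0 → ℓQ q ≤ M * R := by
    intro q hq
    obtain ⟨x, rfl⟩ := H.isOpenQuotientMap.surjective q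
    obtain ⟨n, hn⟩ : ∃ n, f (ι n * x) ≠ 0 := by
      by_contra! h0
      exact hq (by rw [hFf]; simp [h0, l2norm])
    have h1 := hle (ι n * x)
    rw [map_mul, H.mulExact.apply_apply_eq_one, one_mul] at h1
    exact h1.trans (mul_le_mul_of_nonneg_left (hfR _ hn) hM)
  have hconv := HQ (M * R) (by positivity) F' G' hF' hG' hFR
  have hUl : l2norm U ≤ c * (C * (1 + 2 * R) ^ s) * l2norm (convReal F' G') := by
    rw [l2norm, l2norm, ← Real.sqrt_sq (show 0 ≤ c * (C * (1 + 2 * R) ^ s) by positivity),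
      ← Real.sqrt_mul (sq_nonneg _), ← integral_const_mul]
    refine Real.sqrt_le_sqrt (integral_mono hU.sq.integrable
      ((hF'.convReal hG').sq.integrable.const_mul _) fun q => ?_)
    dsimp only
    rw [← mul_pow]
    exact pow_le_pow_left₀ (hU.nonneg q) (hUle q) 2
  have hp1 : (1 + 2 * R) ^ s ≤ 2 ^ s * (1 + R) ^ s := by
    rw [← Real.mul_rpow (by positivity) (by positivity)]
    gcongr
    linarith
  have hp2 : (1 + M * R) ^ t ≤ (1 + M) ^ t * (1 + R) ^ t := by
    rw [← Real.mul_rpow (by positivity) (by positivity)]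
    gcongr
    nlinarith
  have hF0 := l2norm_nonneg F'
  have hG0 := l2norm_nonneg G'
  have hsc : √c * √c = c := Real.mul_self_sqrt hc.le
  rw [hUn, hFn, hGn]
  calc √c * l2norm U ≤ √c * (c * (C * (1 + 2 * R) ^ s) *
        (D * (1 + M * R) ^ t * l2norm F' * l2norm G')) := by
        gcongr
        exact hUl.trans (by gcongr)
    _ ≤ √c * (c * (C * (2 ^ s * (1 + R) ^ s)) *
        (D * ((1 + M) ^ t * (1 + R) ^ t) * l2norm F' * l2norm G')) := by gcongr
    _ = √c * ((√c * √c) * (C * (2 ^ s * (1 + R) ^ s)) *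
        (D * ((1 + M) ^ t * (1 + R) ^ t) * l2norm F' * l2norm G')) := by rw [hsc]
    _ = _ := by rw [Real.rpow_add (by positivity)]; ring

end Extension

end RapidDecay

theorem theorem4p1
    {N G Q : Type*}
    [Group N] [TopologicalSpace N] [IsTopologicalGroup N] [LocallyCompactSpace N] [T2Space N]
    [MeasurableSpace N] [BorelSpace N]
    [Group G] [TopologicalSpace G] [IsTopologicalGroup G] [LocallyCompactSpace G] [T2Space G]
    [MeasurableSpace G] [BorelSpace G]
    [Group Q] [TopologicalSpace Q] [IsTopologicalGroup Q] [LocallyCompactSpace Q] [T2Space Q]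
    [MeasurableSpace Q] [BorelSpace Q]
    (hN : RapidDecay.IsCompactlyGenerated N)
    (hG : RapidDecay.IsCompactlyGenerated G)
    (hQ : RapidDecay.IsCompactlyGenerated Q)
    (ι : N →* G) (π : G →* Q) (hex : TopologicalGroup.IsSES ι π)
    (ℓG : G → ℝ) (hℓG : RapidDecay.IsWordLength ℓG)
    (ℓQ : Q → ℝ) (hℓQ : RapidDecay.IsWordLength ℓQ)
    (hRDQ : RapidDecay.HasRDWith ℓQ)
    (hRDN : RapidDecay.HasRDWith (fun n : N => ℓG (ι n))) :
    RapidDecay.HasPropertyRD G := by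
  have := hG.sigmaCompactSpace
  obtain ⟨s, C, hs, hC, HN⟩ := hRDN.exists_rdBound
  obtain ⟨t, D, ht, hD, HQ⟩ := hRDQ.exists_rdBound
  obtain ⟨M, hM, hle⟩ :=
    (hℓQ.1.comp_monoidHom hex.isOpenQuotientMap.continuous).exists_le_mul_wordLength hℓG
  obtain ⟨E, hE, HG⟩ := HN.extension hex hℓG.1 hs hC ht hD hM hle HQ
  refine ⟨⟨ℓG, hℓG.1, HG.hasRDWith (by positivity) hE⟩, fun ℓ hℓ => ?_⟩
  obtain ⟨M', hM', hle'⟩ := hℓG.1.exists_le_mul_wordLength hℓ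
  exact (HG.of_le (by positivity) hE hM' hle').hasRDWith (by positivity) (by positivity)
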